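/- **Theorem 4.1.** Let $1<p<\infty$ and let $L^p$ be the complex Lebesgue space of the unit circle $\mathbb T$. Let $H^p$ (respectively $K^p$) be the closed subspace of those $g\in L^p$ whose Fourier coefficients $\hat g(n)$ vanish for all $n<0$ (respectively for all $n\ge 0$). The Riesz projection $P$, that is, the operator on $L^p$ with $\widehat{Pg}(n)=\hat g(n)$ for $n\ge 0$ and $\widehat{Pg}(n)=0$ for $n<0$, is well defined and bounded on $L^p$; put $Q=I-P$. For $\varphi\in L^\infty$ let $M_\varphi g=\varphi g$ on $L^p$, and define the Hankel operators $$H_\varphi=PM_\varphi|_{K^p}\colon K^p\to H^p,\qquad \widetilde H_\varphi=QM_\varphi|_{H^p}\colon H^p\to K^p .$$ Let $f$ be a continuous function on $\mathbb T$ in the Wiener algebra, i.e. with $\sum_{n\in\mathbb Z}|\hat f(n)|<\infty$, such that $f(z)\ne 0$ for all $z\in\mathbb T$. Then: 1. $H_f$ and $H_{1/f}$ are matricially coupled, they are equivalent after extension, and they generate the same operator ideal; 2. $\widetilde H_f$ and $\widetilde H_{1/f}$ are matricially coupled, they are equivalent after extension, and they generate the same operator ideal. Here, for bounded operators $U\colon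 X_1\to X_2$ and $V\colon Y_1\to Y_2$ between complex Banach spaces, $U$ and $V$ are *matricially coupled* if there is a boundedly invertible operator $\widehat U\colon X_1\oplus Y_2\to X_2\oplus Y_1$ with $$\widehat U=\begin{pmatrix}U&*\\ *&*\end{pmatrix},\qquad \widehat U^{-1}=\begin{pmatrix}*&*\\ *&V\end{pmatrix};$$ they are *equivalent after extension* if there are Banach spaces $X_0,Y_0$ and boundedly invertible operators $E\colon Y_2\oplus Y_0\to X_2\oplus X_0$ and $F\colon X_1\oplus X_0\to Y_1\oplus Y_0$ with $$\begin{pmatrix}U&0\\0&I_{X_0}\end{pmatrix}=E\begin{pmatrix}V&0\\0&I_{Y_0}\end{pmatrix}F .$$ An *operator ideal* assigns to every pair $(X,Y)$ of complex Banach spaces a linear subspace $\mathfrak A(X,Y)$ of the bounded operators from $X$ to $Y$ that contains all operators of finite rank, such that $STR\in\mathfrak A(W,Z)$ whenever $R\colon W\to X$ and $S\colon Y\to Z$ are bounded and $T\in\mathfrak A(X,Y)$. The operator ideal *generated by* an operator is the smallest operator ideal that contains it. -/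

import Mathlib

open MeasureTheory AddCircle
open scoped ENNReal Real

noncomputable section

namespace HankelCoupling

universe u

/-! ### Relations between Banach space operators -/

section Relations

variable {X₁ X₂ Y₁ Y₂ : Type u}
  [NormedAddCommGroup X₁] [NormedSpace ℂ X₁] [NormedAddCommGroup X₂] [NormedSpace ℂ X₂]
  [NormedAddCommGroup Y₁] [NormedSpace ℂ Y₁] [NormedAddCommGroup Y₂] [NormedSpace ℂ Y₂]

/-- `U : X₁ → X₂` and `V : Y₁ → Y₂` are matricially coupled: there is a boundedly invertible
`M : X₁ ⊕ Y₂ → X₂ ⊕ Y₁` whose upper left corner is `U`, while the lower right corner of `M⁻¹`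
is `V`. -/
def MatriciallyCoupled (U : X₁ →L[ℂ] X₂) (V : Y₁ →L[ℂ] Y₂) : Prop :=
  ∃ M : (X₁ × Y₂) ≃L[ℂ] (X₂ × Y₁),
    (∀ x : X₁, (M (x, 0)).1 = U x) ∧ (∀ y : Y₁, (M.symm (0, y)).2 = V y)

/-- `U : X₁ → X₂` and `V : Y₁ → Y₂` are equivalent after extension: there are Banach spaces
`X₀`, `Y₀` and boundedly invertible operators `E`, `F` with `U ⊕ I_{X₀} = E (V ⊕ I_{Y₀}) F`. -/
def EquivalentAfterExtension (U : X₁ →L[ℂ] X₂) (V : Y₁ →L[ℂ] Y₂) : Prop :=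
  ∃ (X₀ : Type u) (_ : NormedAddCommGroup X₀) (_ : NormedSpace ℂ X₀) (_ : CompleteSpace X₀)
    (Y₀ : Type u) (_ : NormedAddCommGroup Y₀) (_ : NormedSpace ℂ Y₀) (_ : CompleteSpace Y₀)
    (E : (Y₂ × Y₀) ≃L[ℂ] (X₂ × X₀)) (F : (X₁ × X₀) ≃L[ℂ] (Y₁ × Y₀)),
    U.prodMap (ContinuousLinearMap.id ℂ X₀) =
      (E : (Y₂ × Y₀) →L[ℂ] (X₂ × X₀)) ∘L
        (V.prodMap (ContinuousLinearMap.id ℂ Y₀)) ∘L (F : (X₁ × X₀) →L[ℂ] (Y₁ × Y₀))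

end Relations

/-! ### Operator ideals -/

/-- An operator ideal (in the sense of Pietsch) on the class of complex Banach spaces: a linear
subspace `𝔄(X, Y)` of the bounded operators for every pair of Banach spaces, containing all
operators of finite rank and stable under composition from both sides with bounded operators. -/
@[ext]
structure OperatorIdeal where
  /-- The component `𝔄(X, Y)`. -/
  component : ∀ (X Y : Type u) [NormedAddCommGroup X] [NormedSpace ℂ X] [CompleteSpace X]
    [NormedAddCommGroup Y] [NormedSpace ℂ Y] [CompleteSpace Y], Submodule ℂ (X →L[ℂ] Y)
  finiteRank_mem : ∀ (X Y : Type u) [NormedAddCommGroup X] [NormedSpace ℂ X] [CompleteSpace X]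
    [NormedAddCommGroup Y] [NormedSpace ℂ Y] [CompleteSpace Y] (T : X →L[ℂ] Y),
    FiniteDimensional ℂ (LinearMap.range (T : X →ₗ[ℂ] Y)) → T ∈ component X Y
  comp_mem : ∀ (W X Y Z : Type u)
    [NormedAddCommGroup W] [NormedSpace ℂ W] [CompleteSpace W]
    [NormedAddCommGroup X] [NormedSpace ℂ X] [CompleteSpace X]
    [NormedAddCommGroup Y] [NormedSpace ℂ Y] [CompleteSpace Y]
    [NormedAddCommGroup Z] [NormedSpace ℂ Z] [CompleteSpace Z]
    (R : W →L[ℂ] X) (T : X →L[ℂ] Y) (S : Y →L[ℂ] Z),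
    T ∈ component X Y → S ∘L T ∘L R ∈ component W Z

/-- The operator ideal generated by an operator `T`: the smallest operator ideal that contains
`T`, i.e. the intersection of all operator ideals that contain `T`. -/
def OperatorIdeal.generatedBy {X₁ X₂ : Type u}
    [NormedAddCommGroup X₁] [NormedSpace ℂ X₁] [CompleteSpace X₁]
    [NormedAddCommGroup X₂] [NormedSpace ℂ X₂] [CompleteSpace X₂]
    (T : X₁ →L[ℂ] X₂) : OperatorIdeal.{u} where
  component X Y _ _ _ _ _ _ :=
    ⨅ (𝔄 : OperatorIdeal.{u}) (_ : T ∈ 𝔄.component X₁ X₂), 𝔄.component X Y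
  finiteRank_mem X Y _ _ _ _ _ _ S hS := by
    simp only [Submodule.mem_iInf]
    exact fun 𝔄 _ => 𝔄.finiteRank_mem X Y S hS
  comp_mem W X Y Z _ _ _ _ _ _ _ _ _ _ _ _ R S Q hS := by
    simp only [Submodule.mem_iInf] at hS ⊢
    exact fun 𝔄 h𝔄 => 𝔄.comp_mem W X Y Z R S Q (hS 𝔄 h𝔄)

/-! ### Function spaces on the unit circle

The unit circle is parametrized by `t ↦ e^{it}`, `t ∈ ℝ / 2πℤ`, and carries the normalized
Lebesgue measure. -/

instance fact_two_pi_pos : Fact (0 < 2 * π) := ⟨Real.two_pi_pos⟩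

/-- The unit circle, as `ℝ / 2πℤ`. -/
abbrev 𝕋 : Type := AddCircle (2 * π)

/-- The Lebesgue space `L^p` of the unit circle. -/
abbrev LpCircle (p : ℝ≥0∞) : Type := Lp ℂ p (haarAddCircle (T := 2 * π))

/-- A continuous function on the circle belongs to the Wiener algebra if its Fourier
coefficients are absolutely summable. -/
def InWienerAlgebra (f : C(𝕋, ℂ)) : Prop :=
  Summable fun n : ℤ => ‖fourierCoeff (f : 𝕋 → ℂ) n‖

/-- The function `1 / f`, for a continuous function `f` on the circle without zeros. -/
def reciprocal (f : C(𝕋, ℂ)) (hf : ∀ t, f t ≠ 0) : C(𝕋, ℂ) :=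
  ⟨fun t => 1 / f t, continuous_const.div f.continuous hf⟩

/-- A continuous function on the circle as an element of `L^∞`. -/
def toLinfty (f : C(𝕋, ℂ)) : LpCircle ∞ :=
  ContinuousMap.toLp ∞ (haarAddCircle (T := 2 * π)) ℂ f

variable (p : ℝ≥0∞) [Fact (1 ≤ p)]

lemma integrable_of_Lp (g : LpCircle p) : Integrable g (haarAddCircle (T := 2 * π)) :=
  (Lp.memLp g).integrable Fact.out

/-- The `n`-th Fourier coefficient, as a bounded linear functional on `L^p`. -/
def coeffCLM (n : ℤ) : LpCircle p →L[ℂ] ℂ :=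
  LinearMap.mkContinuous
    { toFun := fun g => fourierCoeff (g : 𝕋 → ℂ) n
      map_add' := fun g h => by
        rw [fourierCoeff_congr_ae (Lp.coeFn_add g h),
          fourierCoeff.add (integrable_of_Lp p g) (integrable_of_Lp p h)]
        rfl
      map_smul' := fun c g => by
        rw [fourierCoeff_congr_ae (Lp.coeFn_smul c g), fourierCoeff.const_smul]
        rfl }
    1 (fun g => by
      have h1 : ‖fourierCoeff (g : 𝕋 → ℂ) n‖ ≤
          (eLpNorm (g : 𝕋 → ℂ) 1 (haarAddCircle (T := 2 * π))).toReal := by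
        rw [eLpNorm_one_eq_lintegral_enorm]
        refine (norm_integral_le_lintegral_norm _).trans (le_of_eq ?_)
        congr 1
        refine lintegral_congr fun t => ?_
        rw [norm_smul, fourier_apply, Circle.norm_coe, one_mul, ofReal_norm]
      have h2 : eLpNorm (g : 𝕋 → ℂ) 1 (haarAddCircle (T := 2 * π)) ≤
          eLpNorm (g : 𝕋 → ℂ) p (haarAddCircle (T := 2 * π)) :=
        eLpNorm_le_eLpNorm_of_exponent_le Fact.out (Lp.aestronglyMeasurable g)
      rw [one_mul, Lp.norm_def]
      exact h1.trans (ENNReal.toReal_mono (Lp.eLpNorm_ne_top g) h2))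

/-- The Hardy space `H^p`: the functions in `L^p` whose Fourier coefficients with negative index
vanish. -/
def hardySpace : Submodule ℂ (LpCircle p) :=
  ⨅ (n : ℤ) (_ : n < 0), LinearMap.ker (coeffCLM p n : LpCircle p →ₗ[ℂ] ℂ)

/-- The complementary space `K^p`: the functions in `L^p` whose Fourier coefficients with
nonnegative index vanish. -/
def coHardySpace : Submodule ℂ (LpCircle p) :=
  ⨅ (n : ℤ) (_ : 0 ≤ n), LinearMap.ker (coeffCLM p n : LpCircle p →ₗ[ℂ] ℂ)

variable {p} in
lemma mem_hardySpace {g : LpCircle p} :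
    g ∈ hardySpace p ↔ ∀ n : ℤ, n < 0 → fourierCoeff (g : 𝕋 → ℂ) n = 0 := by
  simp only [hardySpace, Submodule.mem_iInf]
  rfl

variable {p} in
lemma mem_coHardySpace {g : LpCircle p} :
    g ∈ coHardySpace p ↔ ∀ n : ℤ, 0 ≤ n → fourierCoeff (g : 𝕋 → ℂ) n = 0 := by
  simp only [coHardySpace, Submodule.mem_iInf]
  rfl

instance completeSpace_hardySpace : CompleteSpace (hardySpace p) := by
  have h : IsClosed (hardySpace p : Set (LpCircle p)) := by
    simp only [hardySpace, Submodule.coe_iInf]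
    exact isClosed_iInter fun n => isClosed_iInter fun _ => (coeffCLM p n).isClosed_ker
  exact h.completeSpace_coe

instance completeSpace_coHardySpace : CompleteSpace (coHardySpace p) := by
  have h : IsClosed (coHardySpace p : Set (LpCircle p)) := by
    simp only [coHardySpace, Submodule.coe_iInf]
    exact isClosed_iInter fun n => isClosed_iInter fun _ => (coeffCLM p n).isClosed_ker
  exact h.completeSpace_coe

/-- The Riesz projection: the bounded projection `P` of `L^p` onto `H^p` along `K^p`, i.e. the
bounded operator that removes the Fourier coefficients with negative index and keeps the
others. -/
structure RieszProjection where
  /-- The projection as a bounded operator on `L^p`. -/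
  toCLM : LpCircle p →L[ℂ] LpCircle p
  fourierCoeff_toCLM : ∀ (g : LpCircle p) (n : ℤ),
    fourierCoeff (toCLM g : 𝕋 → ℂ) n = if 0 ≤ n then fourierCoeff (g : 𝕋 → ℂ) n else 0

/-! ### Multiplication and Hankel operators -/

/-- The multiplication operator `M_φ g = φ g` on `L^p`, for `φ ∈ L^∞`. -/
def mulOp (φ : LpCircle ∞) : LpCircle p →L[ℂ] LpCircle p :=
  (ContinuousLinearMap.mul ℂ ℂ).holderL (haarAddCircle (T := 2 * π)) ∞ p p φ

variable {p}

namespace RieszProjection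

variable (P : RieszProjection p)

/-- The complementary projection `Q = I - P`. -/
def compl : LpCircle p →L[ℂ] LpCircle p := ContinuousLinearMap.id ℂ (LpCircle p) - P.toCLM

lemma toCLM_mem (g : LpCircle p) : P.toCLM g ∈ hardySpace p :=
  mem_hardySpace.2 fun n hn => by rw [P.fourierCoeff_toCLM, if_neg (not_le.2 hn)]

lemma compl_mem (g : LpCircle p) : P.compl g ∈ coHardySpace p :=
  mem_coHardySpace.2 fun n hn => by
    change coeffCLM p n (g - P.toCLM g) = 0
    rw [map_sub, sub_eq_zero]
    exact ((P.fourierCoeff_toCLM g n).trans (if_pos hn)).symm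

/-- The Hankel operator `H_φ = P M_φ|_{K^p} : K^p → H^p`. -/
def hankel (φ : LpCircle ∞) : coHardySpace p →L[ℂ] hardySpace p :=
  (P.toCLM ∘L mulOp p φ ∘L (coHardySpace p).subtypeL).codRestrict (hardySpace p)
    fun g => P.toCLM_mem (mulOp p φ g)

/-- The Hankel operator `H̃_φ = Q M_φ|_{H^p} : H^p → K^p`. -/
def hankelTilde (φ : LpCircle ∞) : hardySpace p →L[ℂ] coHardySpace p :=
  (P.compl ∘L mulOp p φ ∘L (hardySpace p).subtypeL).codRestrict (coHardySpace p)
    fun g => P.compl_mem (mulOp p φ g)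

end RieszProjection

end HankelCoupling

end

/-!
The operators `H_f` and `H_{1/f}` are the off-diagonal corners in the same position of `M_f` and
of its inverse `M_{1/f}`, written as block operators with respect to `L^p = K^p ⊕ H^p`. Exchanging
the summands of the target turns `M_f` into a coupling operator
(`RieszProjection.matriciallyCoupled_hankel`). That matricially coupled operators are equivalent
after extension is a computation with block operators
(`MatriciallyCoupled.equivalentAfterExtension`).

Equivalence after extension alone does not force the generated ideals to agree: the identity of an
infinite dimensional space is equivalent after extension to the zero operator on the zero space.
Here the operators are moreover limits in norm of operators of finite rank: `f` is a uniform limit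
of trigonometric polynomials, and the Hankel operator of a trigonometric polynomial has finite rank
(`RieszProjection.isApproximable_hankel`). For a coupling `M = (U, U₁₂; U₂₁, U₂₂)` with inverse
`M⁻¹ = (V₁₁, V₁₂; V₂₁, V)` one has `U (I - V₁₁ U) = -U₁₂ V U₂₁`, which lies in every ideal that
contains `V`; if `U` is approximable, then `I - V₁₁ U` is invertible modulo operators of finite
rank, and `U` itself lies in these ideals (`MatriciallyCoupled.generatedBy_eq`).

The boundedness of the Riesz projection is M. Riesz's theorem (`nonempty_rieszProjection`). For
`1 < p ≤ 2` and a trigonometric polynomial with positive real part `v` on the circle, `v` is the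
real part of an entire function `F`, real at `0`, and `re F > 0` in the disc. The pointwise
inequality `‖z‖ ^ p ≤ A (re z) ^ p - B re (z ^ p)` for `re z > 0`, integrated along the circle,
gives `∫ ‖F‖ ^ p ≤ A ∫ v ^ p`, since by the mean value property the last term integrates to
`B (F 0) ^ p ≥ 0`. An arbitrary trigonometric polynomial is split into the positive and negative
parts of its real and imaginary parts; these are approximated uniformly by positive trigonometric
polynomials, and the remainder is controlled in `L²`. The case `p > 2` follows by duality.
-/

namespace HankelCoupling

/-! ### Couplings and operator ideals -/

universe u

section Relations

variable {X₁ X₂ Y₁ Y₂ : Type u}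
  [NormedAddCommGroup X₁] [NormedSpace ℂ X₁] [NormedAddCommGroup X₂] [NormedSpace ℂ X₂]
  [NormedAddCommGroup Y₁] [NormedSpace ℂ Y₁] [NormedAddCommGroup Y₂] [NormedSpace ℂ Y₂]
  {U : X₁ →L[ℂ] X₂} {V : Y₁ →L[ℂ] Y₂}

theorem MatriciallyCoupled.symm (h : MatriciallyCoupled U V) : MatriciallyCoupled V U := by
  obtain ⟨M, hU, hV⟩ := h
  refine ⟨((ContinuousLinearEquiv.prodComm ℂ Y₁ X₂).trans M.symm).trans
    (ContinuousLinearEquiv.prodComm ℂ X₁ Y₂), fun y => ?_, fun x => ?_⟩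
  · simpa using hV y
  · simpa using hU x

/-- With `M = (U, U₁₂; U₂₁, U₂₂)` and `M⁻¹ = (V₁₁, V₁₂; V₂₁, V)`, one has
`U ⊕ I_{Y₁} = E (V ⊕ I_{X₁}) F`. Up to the order of summands, `E` is `M` and
`F (x, y) = (y - U₂₁ x, x + V₁₂ (y - U₂₁ x))` is a product of two shears. -/
theorem MatriciallyCoupled.equivalentAfterExtension [CompleteSpace X₁] [CompleteSpace Y₁]
    (h : MatriciallyCoupled U V) : EquivalentAfterExtension U V := by
  obtain ⟨M, hU, hV⟩ := h
  let U₂₁ : X₁ →L[ℂ] Y₁ := .snd ℂ X₂ Y₁ ∘L (M : (X₁ × Y₂) →L[ℂ] (X₂ × Y₁)) ∘L .inl ℂ X₁ Y₂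
  let V₁₂ : Y₁ →L[ℂ] X₁ := .fst ℂ X₁ Y₂ ∘L (M.symm : (X₂ × Y₁) →L[ℂ] (X₁ × Y₂)) ∘L .inr ℂ X₂ Y₁
  let F : (X₁ × Y₁) ≃L[ℂ] (Y₁ × X₁) := ContinuousLinearEquiv.equivOfInverse
    ((ContinuousLinearMap.snd ℂ X₁ Y₁ - U₂₁ ∘L .fst ℂ X₁ Y₁).prod
      (.fst ℂ X₁ Y₁ + V₁₂ ∘L (.snd ℂ X₁ Y₁ - U₂₁ ∘L .fst ℂ X₁ Y₁)))
    ((ContinuousLinearMap.snd ℂ Y₁ X₁ - V₁₂ ∘L .fst ℂ Y₁ X₁).prod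
      (.fst ℂ Y₁ X₁ + U₂₁ ∘L (.snd ℂ Y₁ X₁ - V₁₂ ∘L .fst ℂ Y₁ X₁)))
    (fun a => by ext <;> simp) (fun a => by ext <;> simp)
  refine ⟨Y₁, _, _, ‹_›, X₁, _, _, ‹_›,
    (ContinuousLinearEquiv.prodComm ℂ Y₂ X₁).trans M, F, ?_⟩
  refine ContinuousLinearMap.ext fun ⟨x, y⟩ => ?_
  have hM : M (x, 0) = (U x, U₂₁ x) := Prod.ext (hU x) rfl
  have hM' : M.symm (0, y - U₂₁ x) = (V₁₂ (y - U₂₁ x), V (y - U₂₁ x)) := Prod.ext rfl (hV _)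
  have key : (x + V₁₂ (y - U₂₁ x), V (y - U₂₁ x)) = (x, (0 : Y₂)) + M.symm (0, y - U₂₁ x) := by
    rw [hM', Prod.mk_add_mk, zero_add]
  change (U x, y) = M (x + V₁₂ (y - U₂₁ x), V (y - U₂₁ x))
  rw [key, map_add, M.apply_symm_apply, hM]
  simp

/-- The operators that are limits in operator norm of operators of finite rank. -/
def IsApproximable (U : X₁ →L[ℂ] X₂) : Prop :=
  ∀ ε > 0, ∃ T : X₁ →L[ℂ] X₂,
    FiniteDimensional ℂ (LinearMap.range (T : X₁ →ₗ[ℂ] X₂)) ∧ ‖U - T‖ < ε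

end Relations

section Ideals

variable {X₁ X₂ Y₁ Y₂ : Type u}
  [NormedAddCommGroup X₁] [NormedSpace ℂ X₁] [CompleteSpace X₁]
  [NormedAddCommGroup X₂] [NormedSpace ℂ X₂] [CompleteSpace X₂]
  [NormedAddCommGroup Y₁] [NormedSpace ℂ Y₁] [CompleteSpace Y₁]
  [NormedAddCommGroup Y₂] [NormedSpace ℂ Y₂] [CompleteSpace Y₂]
  {U : X₁ →L[ℂ] X₂} {V : Y₁ →L[ℂ] Y₂}

/-- If `U` is approximable and `U (I - B U)` lies in an operator ideal, then so does `U`: since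
`B U` is a small perturbation of a finite rank operator, `I - B U` has a right inverse modulo
operators of finite rank. -/
theorem OperatorIdeal.mem_of_comp_one_sub_mem (𝔄 : OperatorIdeal.{u}) (hU : IsApproximable U)
    (B : X₂ →L[ℂ] X₁) (h : U ∘L (1 - B ∘L U) ∈ 𝔄.component X₁ X₂) :
    U ∈ 𝔄.component X₁ X₂ := by
  obtain ⟨T, hT, hUT⟩ := hU (‖B‖ + 1)⁻¹ (by positivity)
  have hT' : T ∈ 𝔄.component X₁ X₂ := 𝔄.finiteRank_mem _ _ T hT
  have hsmall : ‖B ∘L (U - T)‖ < 1 := by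
    calc ‖B ∘L (U - T)‖ ≤ ‖B‖ * ‖U - T‖ := B.opNorm_comp_le _
      _ ≤ ‖B‖ * (‖B‖ + 1)⁻¹ := by gcongr
      _ < 1 := by
        rw [← div_eq_mul_inv, div_lt_one (by positivity)]
        linarith
  obtain ⟨S, hS⟩ : ∃ S : X₁ →L[ℂ] X₁, (1 - B ∘L (U - T)) * S = 1 :=
    (isUnit_one_sub_of_norm_lt_one hsmall).exists_right_inv
  have key : U = (U ∘L (1 - B ∘L U)) ∘L S + (U ∘L B) ∘L T ∘L S := by
    ext x
    have hx : S x - B (U (S x) - T (S x)) = x := by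
      simpa using DFunLike.congr_fun hS x
    have : U x = U (S x - B (U (S x) - T (S x))) := by rw [hx]
    rw [this]
    simp only [map_sub, add_apply, ContinuousLinearMap.comp_apply,
      sub_apply, one_apply_eq_self]
    abel
  rw [key]
  refine Submodule.add_mem _ ?_ ?_
  · exact 𝔄.comp_mem _ _ _ _ S _ (ContinuousLinearMap.id ℂ X₂) h
  · exact 𝔄.comp_mem _ _ _ _ S T (U ∘L B) hT'

theorem MatriciallyCoupled.mem_ideal (h : MatriciallyCoupled U V) (hU : IsApproximable U)
    (𝔄 : OperatorIdeal.{u}) (hV : V ∈ 𝔄.component Y₁ Y₂) : U ∈ 𝔄.component X₁ X₂ := by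
  obtain ⟨M, hMU, hMV⟩ := h
  let U₁₂ : Y₂ →L[ℂ] X₂ := .fst ℂ X₂ Y₁ ∘L (M : (X₁ × Y₂) →L[ℂ] (X₂ × Y₁)) ∘L .inr ℂ X₁ Y₂
  let U₂₁ : X₁ →L[ℂ] Y₁ := .snd ℂ X₂ Y₁ ∘L (M : (X₁ × Y₂) →L[ℂ] (X₂ × Y₁)) ∘L .inl ℂ X₁ Y₂
  let V₁₁ : X₂ →L[ℂ] X₁ := .fst ℂ X₁ Y₂ ∘L (M.symm : (X₂ × Y₁) →L[ℂ] (X₁ × Y₂)) ∘L .inl ℂ X₂ Y₁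
  refine 𝔄.mem_of_comp_one_sub_mem hU V₁₁ ?_
  -- The entries of `M⁻¹ M = I` and `M M⁻¹ = I` give `U (I - V₁₁ U) = U V₁₂ U₂₁ = -U₁₂ V U₂₁`.
  have key : U ∘L (1 - V₁₁ ∘L U) = -(U₁₂ ∘L V ∘L U₂₁) := by
    ext x
    have h1 : M (x, 0) = (U x, 0) + (0, U₂₁ x) := by
      rw [Prod.mk_add_mk, add_zero, zero_add]
      exact Prod.ext (hMU x) rfl
    have h2 : (x, (0 : Y₂)) = M.symm (U x, 0) + M.symm (0, U₂₁ x) := by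
      rw [← map_add, ← h1, M.symm_apply_apply]
    have h3 : M.symm (0, U₂₁ x) = (x - V₁₁ (U x), 0) + (0, V (U₂₁ x)) := by
      rw [Prod.mk_add_mk, add_zero, zero_add]
      refine Prod.ext ?_ (hMV _)
      have := congrArg Prod.fst h2
      simp only [Prod.fst_add] at this
      exact eq_sub_of_add_eq' this.symm
    have h4 := congrArg (fun z => (M z).1) h3
    simp only [M.apply_symm_apply, map_add, Prod.fst_add, hMU] at h4
    exact eq_neg_of_add_eq_zero_left h4.symm
  rw [key]
  exact Submodule.neg_mem _ (𝔄.comp_mem _ _ _ _ U₂₁ V U₁₂ hV)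

theorem MatriciallyCoupled.generatedBy_eq (h : MatriciallyCoupled U V) (hU : IsApproximable U)
    (hV : IsApproximable V) :
    OperatorIdeal.generatedBy U = OperatorIdeal.generatedBy V := by
  have hiff (𝔄 : OperatorIdeal.{u}) : U ∈ 𝔄.component X₁ X₂ ↔ V ∈ 𝔄.component Y₁ Y₂ :=
    ⟨h.symm.mem_ideal hV 𝔄, h.mem_ideal hU 𝔄⟩
  simp only [OperatorIdeal.generatedBy, hiff]

end Ideals

/-! ### Fourier coefficients and Hankel operators -/

section Coefficients

variable (p : ℝ≥0∞) [Fact (1 ≤ p)]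

lemma coeFn_mulOp (f : C(𝕋, ℂ)) (g : LpCircle p) :
    mulOp p (toLinfty f) g =ᵐ[haarAddCircle (T := 2 * π)] fun t => f t * g t := by
  filter_upwards [(ContinuousLinearMap.mul ℂ ℂ).coeFn_holder (r := p) (toLinfty f) g,
    ContinuousMap.coeFn_toLp (p := ∞) (𝕜 := ℂ) (haarAddCircle (T := 2 * π)) f] with t h1 h2
  refine h1.trans ?_
  rw [ContinuousLinearMap.mul_apply']
  congr 1

lemma coeffCLM_apply (n : ℤ) (g : LpCircle p) :
    coeffCLM p n g = fourierCoeff (g : 𝕋 → ℂ) n := rfl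

lemma coeffCLM_toLp (n : ℤ) (f : C(𝕋, ℂ)) :
    coeffCLM p n (ContinuousMap.toLp p (haarAddCircle (T := 2 * π)) ℂ f) = fourierCoeff f n := by
  rw [coeffCLM_apply, fourierCoeff_congr_ae (ContinuousMap.coeFn_toLp _ f)]

lemma coeffCLM_fourierLp (n m : ℤ) :
    coeffCLM p n (fourierLp p m) = if n = m then 1 else 0 := by
  rw [coeffCLM_toLp, fourierCoeff_fourier, Pi.single_apply]

lemma coeffCLM_mulOp_fourier (n m : ℤ) (g : LpCircle p) :
    coeffCLM p n (mulOp p (toLinfty (fourier m)) g) = coeffCLM p (n - m) g := by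
  simp only [coeffCLM_apply]
  rw [fourierCoeff_congr_ae (coeFn_mulOp p _ g)]
  refine integral_congr_ae (.of_forall fun t => ?_)
  simp only [smul_eq_mul]
  rw [← mul_assoc, ← fourier_add, neg_sub, neg_add_eq_sub]

variable {p}

lemma lpPairing_fourierLp {q : ℝ≥0∞} [Fact (1 ≤ q)] [p.HolderConjugate q] (g : LpCircle p) (n : ℤ) :
    (ContinuousLinearMap.mul ℂ ℂ).lpPairing (haarAddCircle (T := 2 * π)) p q g (fourierLp q n) =
      coeffCLM p (-n) g := by
  rw [ContinuousLinearMap.lpPairing_eq_integral]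
  refine integral_congr_ae ?_
  filter_upwards [coeFn_fourierLp (T := 2 * π) q n] with t ht
  rw [ht, ContinuousLinearMap.mul_apply', mul_comm, smul_eq_mul, neg_neg]

/-- An `L^p` function whose Fourier coefficients vanish is orthogonal to the span of the
exponentials, which is dense in `L^q` for the conjugate exponent `q < ∞`. -/
theorem eq_zero_of_coeffCLM_eq_zero (hp : 1 < p) {g : LpCircle p}
    (hg : ∀ n, coeffCLM p n g = 0) : g = 0 := by
  let q := p.conjExponent
  have hpq : p.HolderConjugate q := .conjExponent hp.le
  have hq : Fact (1 ≤ q) := ⟨hpq.symm.one_le⟩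
  have hq' : q ≠ ∞ := fun h => hp.ne' (by
    have := ENNReal.HolderConjugate.inv_add_inv_eq_one p q
    rwa [h, ENNReal.inv_top, add_zero, ENNReal.inv_eq_one] at this)
  have hzero : (ContinuousLinearMap.mul ℂ ℂ).lpPairing (haarAddCircle (T := 2 * π)) p q g = 0 := by
    refine ContinuousLinearMap.ext_on (s := Set.range (fourierLp q)) ?_ ?_
    · rw [dense_iff_closure_eq, ← Submodule.topologicalClosure_coe,
        span_fourierLp_closure_eq_top hq', Submodule.top_coe]
    · rintro _ ⟨n, rfl⟩
      rw [lpPairing_fourierLp, hg]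
      rfl
  have hae : (g : 𝕋 → ℂ) =ᵐ[haarAddCircle (T := 2 * π)] 0 := by
    refine (integrable_of_Lp p g).ae_eq_zero_of_forall_setIntegral_eq_zero fun s hs hμs => ?_
    have := DFunLike.congr_fun hzero (indicatorConstLp q hs hμs.ne (1 : ℂ))
    rw [ContinuousLinearMap.lpPairing_eq_integral] at this
    rw [← integral_indicator hs]
    refine Eq.trans (integral_congr_ae ?_) this
    filter_upwards [indicatorConstLp_coeFn (p := q) (hs := hs) (hμs := hμs.ne) (c := (1 : ℂ))]
      with t ht
    rw [ht, ContinuousLinearMap.mul_apply']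
    by_cases hts : t ∈ s <;> simp [hts]
  exact (Lp.eq_zero_iff_ae_eq_zero).2 hae

theorem ext_coeffCLM (hp : 1 < p) {g h : LpCircle p}
    (hgh : ∀ n, coeffCLM p n g = coeffCLM p n h) : g = h :=
  sub_eq_zero.1 (eq_zero_of_coeffCLM_eq_zero hp fun n => by rw [map_sub, hgh, sub_self])

/-- A bounded operator whose values have Fourier coefficients supported on a fixed finite set has
finite rank. -/
theorem finiteDimensional_range_of_coeffCLM (hp : 1 < p) {X : Type*} [NormedAddCommGroup X]
    [NormedSpace ℂ X] {E : Submodule ℂ (LpCircle p)} (T : X →L[ℂ] E) (S : Finset ℤ)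
    (hT : ∀ x, ∀ n ∉ S, coeffCLM p n (T x) = 0) :
    FiniteDimensional ℂ (LinearMap.range (T : X →ₗ[ℂ] E)) := by
  let c : LinearMap.range (T : X →ₗ[ℂ] E) →ₗ[ℂ] (S → ℂ) :=
    LinearMap.pi fun n => (coeffCLM p n : LpCircle p →ₗ[ℂ] ℂ) ∘ₗ E.subtype ∘ₗ Submodule.subtype _
  refine FiniteDimensional.of_injective c (LinearMap.ker_eq_bot.1 (LinearMap.ker_eq_bot'.2 ?_))
  rintro ⟨_, x, rfl⟩ hx
  refine Subtype.ext (Subtype.ext (eq_zero_of_coeffCLM_eq_zero hp fun n => ?_))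
  by_cases hn : n ∈ S
  · exact congrFun hx ⟨n, hn⟩
  · exact hT x n hn

end Coefficients

section Hankel

variable {p : ℝ≥0∞} [Fact (1 ≤ p)]

theorem mulOp_one (g : LpCircle p) : mulOp p (toLinfty 1) g = g := by
  refine Lp.ext ?_
  filter_upwards [coeFn_mulOp p 1 g] with t ht
  rw [ht, ContinuousMap.one_apply, one_mul]

theorem mulOp_mulOp (f₁ f₂ : C(𝕋, ℂ)) (g : LpCircle p) :
    mulOp p (toLinfty f₁) (mulOp p (toLinfty f₂) g) = mulOp p (toLinfty (f₁ * f₂)) g := by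
  refine Lp.ext ?_
  filter_upwards [coeFn_mulOp p (f₁ * f₂) g, coeFn_mulOp p f₂ g,
    coeFn_mulOp p f₁ (mulOp p (toLinfty f₂) g)] with t h1 h2 h3
  rw [h1, h3, h2, ContinuousMap.mul_apply, mul_assoc]

/-- Multiplication by a continuous function without zeros, as an invertible operator. -/
noncomputable def mulEquiv (f : C(𝕋, ℂ)) (hf : ∀ t, f t ≠ 0) : LpCircle p ≃L[ℂ] LpCircle p :=
  ContinuousLinearEquiv.equivOfInverse (mulOp p (toLinfty f))
    (mulOp p (toLinfty (reciprocal f hf)))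
    (fun g => by
      rw [mulOp_mulOp, show reciprocal f hf * f = 1 from ContinuousMap.ext fun t =>
        one_div_mul_cancel (hf t), mulOp_one])
    (fun g => by
      rw [mulOp_mulOp, show f * reciprocal f hf = 1 from ContinuousMap.ext fun t =>
        mul_one_div_cancel (hf t), mulOp_one])

/-- Compressions of multiplication operators by continuous functions are approximable, if those
of multiplication by the exponentials have finite rank. -/
theorem isApproximable_comp_mulOp_comp {X Y : Type} [NormedAddCommGroup X] [NormedSpace ℂ X]
    [NormedAddCommGroup Y] [NormedSpace ℂ Y] (A : LpCircle p →L[ℂ] Y) (B : X →L[ℂ] LpCircle p)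
    (h : ∀ n : ℤ, FiniteDimensional ℂ
      (LinearMap.range (A ∘L mulOp p (toLinfty (fourier n)) ∘L B : X →ₗ[ℂ] Y)))
    (f : C(𝕋, ℂ)) : IsApproximable (A ∘L mulOp p (toLinfty f) ∘L B) := by
  let Φ : C(𝕋, ℂ) →L[ℂ] (X →L[ℂ] Y) :=
    (ContinuousLinearMap.compL ℂ X (LpCircle p) Y A) ∘L
      ((ContinuousLinearMap.compL ℂ X (LpCircle p) (LpCircle p)).flip B) ∘L
      ((ContinuousLinearMap.mul ℂ ℂ).holderL (haarAddCircle (T := 2 * π)) ∞ p p) ∘L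
      (ContinuousMap.toLp ∞ (haarAddCircle (T := 2 * π)) ℂ)
  have hspan : ∀ t ∈ Submodule.span ℂ (Set.range (fourier (T := 2 * π))),
      FiniteDimensional ℂ (LinearMap.range (Φ t : X →ₗ[ℂ] Y)) := by
    intro t ht
    induction ht using Submodule.span_induction with
    | mem t ht =>
      obtain ⟨n, rfl⟩ := ht
      exact h n
    | zero =>
      rw [map_zero]
      have : LinearMap.range ((0 : X →L[ℂ] Y) : X →ₗ[ℂ] Y) = ⊥ := LinearMap.range_zero
      rw [this]
      infer_instance
    | add s t _ _ hs ht =>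
      rw [map_add]
      exact Submodule.finiteDimensional_of_le (LinearMap.range_add_le (Φ s : X →ₗ[ℂ] Y) (Φ t))
    | smul c t _ ht =>
      rw [map_smul]
      refine Submodule.finiteDimensional_of_le (S₂ := LinearMap.range (Φ t : X →ₗ[ℂ] Y)) ?_
      rintro _ ⟨x, rfl⟩
      exact ⟨c • x, map_smul (Φ t) c x⟩
  intro ε hε
  have hf : f ∈ closure (Submodule.span ℂ (Set.range (fourier (T := 2 * π))) : Set C(𝕋, ℂ)) := by
    rw [← Submodule.topologicalClosure_coe, span_fourier_closure_eq_top]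
    trivial
  obtain ⟨t, htε, ht⟩ := mem_closure_iff_nhds.1 hf _
    ((Metric.continuous_iff'.1 Φ.continuous) f ε hε)
  refine ⟨Φ t, hspan t ht, ?_⟩
  rw [← dist_eq_norm, dist_comm]
  exact htε

namespace RieszProjection

variable (P : RieszProjection p)

lemma coeffCLM_toCLM (n : ℤ) (g : LpCircle p) :
    coeffCLM p n (P.toCLM g) = if 0 ≤ n then coeffCLM p n g else 0 := P.fourierCoeff_toCLM g n

lemma coeffCLM_compl (n : ℤ) (g : LpCircle p) :
    coeffCLM p n (P.compl g) = if 0 ≤ n then 0 else coeffCLM p n g := by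
  change coeffCLM p n (g - P.toCLM g) = _
  rw [map_sub, P.coeffCLM_toCLM]
  split_ifs <;> simp

lemma toCLM_of_mem_hardySpace (hp : 1 < p) {g : LpCircle p} (hg : g ∈ hardySpace p) :
    P.toCLM g = g := by
  refine ext_coeffCLM hp fun n => ?_
  rw [P.coeffCLM_toCLM]
  split_ifs with hn
  · rfl
  · exact (mem_hardySpace.1 hg n (not_le.1 hn)).symm

lemma toCLM_of_mem_coHardySpace (hp : 1 < p) {g : LpCircle p} (hg : g ∈ coHardySpace p) :
    P.toCLM g = 0 := by
  refine eq_zero_of_coeffCLM_eq_zero hp fun n => ?_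
  rw [P.coeffCLM_toCLM]
  split_ifs with hn
  · exact mem_coHardySpace.1 hg n hn
  · rfl

/-- The Riesz projection splits `L^p` as the direct sum of `K^p` and `H^p`. -/
noncomputable def splitting (hp : 1 < p) :
    LpCircle p ≃L[ℂ] (coHardySpace p × hardySpace p) :=
  ContinuousLinearEquiv.equivOfInverse
    ((P.compl.codRestrict _ P.compl_mem).prod (P.toCLM.codRestrict _ P.toCLM_mem))
    ((coHardySpace p).subtypeL.coprod (hardySpace p).subtypeL)
    (fun g => sub_add_cancel g (P.toCLM g))
    (fun ⟨k, h⟩ => by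
      have hsum : P.toCLM ((k : LpCircle p) + h) = h := by
        rw [map_add, P.toCLM_of_mem_coHardySpace hp k.2, P.toCLM_of_mem_hardySpace hp h.2, zero_add]
      refine Prod.ext (Subtype.ext ?_) (Subtype.ext hsum)
      change (k : LpCircle p) + h - P.toCLM (k + h) = k
      rw [hsum, add_sub_cancel_right])

/-- The coupling operator is `M_f`, written in the splittings `K^p ⊕ H^p` of its domain and
`H^p ⊕ K^p` of its target. -/
theorem matriciallyCoupled_hankel (hp : 1 < p) (f : C(𝕋, ℂ)) (hf : ∀ t, f t ≠ 0) :
    MatriciallyCoupled (P.hankel (toLinfty f)) (P.hankel (toLinfty (reciprocal f hf))) := by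
  refine ⟨(((P.splitting hp).symm.trans (mulEquiv f hf)).trans (P.splitting hp)).trans
    (ContinuousLinearEquiv.prodComm ℂ _ _), fun k => ?_, fun k => ?_⟩
  · refine Subtype.ext ?_
    change P.toCLM (mulOp p (toLinfty f) ((k : LpCircle p) + 0)) =
      P.toCLM (mulOp p (toLinfty f) k)
    rw [add_zero]
  · refine Subtype.ext ?_
    change P.toCLM (mulOp p (toLinfty (reciprocal f hf)) ((k : LpCircle p) + 0)) =
      P.toCLM (mulOp p (toLinfty (reciprocal f hf)) k)
    rw [add_zero]

theorem matriciallyCoupled_hankelTilde (hp : 1 < p) (f : C(𝕋, ℂ)) (hf : ∀ t, f t ≠ 0) :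
    MatriciallyCoupled (P.hankelTilde (toLinfty f))
      (P.hankelTilde (toLinfty (reciprocal f hf))) := by
  refine ⟨(((ContinuousLinearEquiv.prodComm ℂ _ _).trans (P.splitting hp).symm).trans
    (mulEquiv f hf)).trans (P.splitting hp), fun k => ?_, fun k => ?_⟩
  · refine Subtype.ext ?_
    change P.compl (mulOp p (toLinfty f) (0 + (k : LpCircle p))) =
      P.compl (mulOp p (toLinfty f) k)
    rw [zero_add]
  · refine Subtype.ext ?_
    change P.compl (mulOp p (toLinfty (reciprocal f hf)) (0 + (k : LpCircle p))) =
      P.compl (mulOp p (toLinfty (reciprocal f hf)) k)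
    rw [zero_add]

/-- For the exponential `e_m`, the range of the Hankel operator is spanned by the `e_n` with
`0 ≤ n < m`. -/
theorem isApproximable_hankel (hp : 1 < p) (f : C(𝕋, ℂ)) :
    IsApproximable (P.hankel (toLinfty f)) := by
  refine isApproximable_comp_mulOp_comp (P.toCLM.codRestrict _ P.toCLM_mem)
    (coHardySpace p).subtypeL (fun m => ?_) f
  refine finiteDimensional_range_of_coeffCLM hp _ (Finset.Ico 0 m) fun k n hn => ?_
  change coeffCLM p n (P.toCLM (mulOp p (toLinfty (fourier m)) k)) = 0
  rw [P.coeffCLM_toCLM, coeffCLM_mulOp_fourier]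
  split_ifs with h
  · exact mem_coHardySpace.1 k.2 _ (by simp at hn; lia)
  · rfl

theorem isApproximable_hankelTilde (hp : 1 < p) (f : C(𝕋, ℂ)) :
    IsApproximable (P.hankelTilde (toLinfty f)) := by
  refine isApproximable_comp_mulOp_comp (P.compl.codRestrict _ P.compl_mem)
    (hardySpace p).subtypeL (fun m => ?_) f
  refine finiteDimensional_range_of_coeffCLM hp _ (Finset.Ico m 0) fun k n hn => ?_
  change coeffCLM p n (P.compl (mulOp p (toLinfty (fourier m)) k)) = 0
  rw [P.coeffCLM_compl, coeffCLM_mulOp_fourier]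
  split_ifs with h
  · rfl
  · exact mem_hardySpace.1 k.2 _ (by simp at hn; lia)

end RieszProjection

end Hankel

/-! ### Holomorphic functions with positive real part -/

section Pointwise

/-- For `1 < r ≤ 2` the number `cos (r φ)` is negative as `|φ|` approaches `π / 2`, where `cos φ`
degenerates, so that a multiple of `-cos (r φ)` compensates there. -/
theorem exists_one_le_cos_rpow_sub_cos {r : ℝ} (hr : 1 < r) (hr2 : r ≤ 2) :
    ∃ A B : ℝ, 0 ≤ A ∧ 0 ≤ B ∧ ∀ φ : ℝ, |φ| < π / 2 →
      1 ≤ A * Real.cos φ ^ r - B * Real.cos (φ * r) := by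
  have hπ := Real.pi_pos
  -- A threshold strictly between `π / (2 r)` and `π / 2`.
  let θ : ℝ := π / (4 * r) + π / 4
  have hθr : θ * r = π / 4 + π / 4 * r := by simp only [θ]; field_simp
  have hθ1 : π / 2 < θ * r := by rw [hθr]; nlinarith
  have hθ0 : 0 < θ := by positivity
  have hθ2 : θ < π / 2 := by
    have : θ * r < π / 2 * r := by rw [hθr]; nlinarith
    exact lt_of_mul_lt_mul_right this (by linarith)
  have hneg : Real.cos (θ * r) < 0 := by
    refine Real.cos_neg_of_pi_div_two_lt_of_lt hθ1 ?_
    rw [hθr]; nlinarith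
  have hpos : 0 < Real.cos θ := Real.cos_pos_of_mem_Ioo ⟨by linarith, hθ2⟩
  have hpos' : 0 < Real.cos θ ^ r := Real.rpow_pos_of_pos hpos r
  have hB : 0 ≤ (-Real.cos (θ * r))⁻¹ := by
    rw [inv_nonneg]; linarith
  refine ⟨(1 + (-Real.cos (θ * r))⁻¹) / Real.cos θ ^ r, (-Real.cos (θ * r))⁻¹, by positivity, hB,
    fun φ hφ => ?_⟩
  have habs : Real.cos (φ * r) = Real.cos (|φ| * r) := by
    rw [← Real.cos_abs, abs_mul, abs_of_pos (by linarith : 0 < r)]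
  have hcos : 0 ≤ Real.cos φ := Real.cos_nonneg_of_neg_pi_div_two_le_of_le
    (by linarith [(abs_lt.1 hφ).1]) (by linarith [(abs_lt.1 hφ).2])
  rcases le_total θ |φ| with h | h
  · have h1 : Real.cos (|φ| * r) ≤ Real.cos (θ * r) :=
      Real.cos_le_cos_of_nonneg_of_le_pi (by positivity) (by nlinarith) (by gcongr)
    have h2 : (-Real.cos (θ * r))⁻¹ * Real.cos (|φ| * r) ≤ -1 := by
      calc _ ≤ (-Real.cos (θ * r))⁻¹ * Real.cos (θ * r) := by gcongr
        _ = -1 := by rw [inv_neg, neg_mul, inv_mul_cancel₀ hneg.ne]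
    have h3 : 0 ≤ (1 + (-Real.cos (θ * r))⁻¹) / Real.cos θ ^ r * Real.cos φ ^ r := by positivity
    rw [habs]
    linarith
  · have h1 : Real.cos θ ≤ Real.cos φ := by
      rw [← Real.cos_abs φ]
      exact Real.cos_le_cos_of_nonneg_of_le_pi (abs_nonneg _) (by linarith) h
    have h2 : 1 + (-Real.cos (θ * r))⁻¹ ≤
        (1 + (-Real.cos (θ * r))⁻¹) / Real.cos θ ^ r * Real.cos φ ^ r := by
      rw [div_mul_eq_mul_div, le_div_iff₀ hpos']
      gcongr
    have h3 : (-Real.cos (θ * r))⁻¹ * Real.cos (φ * r) ≤ (-Real.cos (θ * r))⁻¹ * 1 := by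
      gcongr
      exact Real.cos_le_one _
    linarith

theorem exists_norm_rpow_le {r : ℝ} (hr : 1 < r) (hr2 : r ≤ 2) :
    ∃ A B : ℝ, 0 ≤ A ∧ 0 ≤ B ∧ ∀ z : ℂ, 0 < z.re →
      ‖z‖ ^ r ≤ A * z.re ^ r - B * (z ^ (r : ℂ)).re := by
  obtain ⟨A, B, hA, hB, h⟩ := exists_one_le_cos_rpow_sub_cos hr hr2
  refine ⟨A, B, hA, hB, fun z hz => ?_⟩
  have hφ : |z.arg| < π / 2 := Complex.abs_arg_lt_pi_div_two_iff.2 (.inl hz)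
  have hcos : 0 ≤ Real.cos z.arg := Real.cos_nonneg_of_neg_pi_div_two_le_of_le
    (by linarith [(abs_lt.1 hφ).1]) (by linarith [(abs_lt.1 hφ).2])
  rw [Complex.cpow_ofReal_re, ← Complex.norm_mul_cos_arg z,
    Real.mul_rpow (norm_nonneg z) hcos]
  have := mul_le_mul_of_nonneg_left (h z.arg hφ) (Real.rpow_nonneg (norm_nonneg z) r)
  linarith

end Pointwise

section Disc

lemma norm_toCircle (t : 𝕋) : ‖(toCircle t : ℂ)‖ = 1 := Circle.norm_coe _

lemma exists_toCircle_eq {z : ℂ} (hz : ‖z‖ = 1) : ∃ t : 𝕋, (toCircle t : ℂ) = z := by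
  obtain ⟨t, ht⟩ := (homeomorphCircle (T := 2 * π) Real.two_pi_pos.ne').surjective
    ⟨z, mem_sphere_zero_iff_norm.2 hz⟩
  rw [homeomorphCircle_apply] at ht
  exact ⟨t, congrArg Subtype.val ht⟩

lemma circleAverage_eq_integral_toCircle (G : ℂ → ℂ) :
    Real.circleAverage G 0 1 = ∫ t : 𝕋, G (toCircle t) ∂haarAddCircle := by
  rw [Real.circleAverage_def, integral_haarAddCircle,
    ← AddCircle.intervalIntegral_preimage (2 * π) 0, zero_add]
  congr 1
  refine intervalIntegral.integral_congr fun θ _ => ?_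
  simp only [toCircle_apply_mk, circleMap, Circle.coe_exp]
  congr 1
  rw [div_self Real.two_pi_pos.ne']
  simp

/-- A lower bound for the real part of a holomorphic function on the unit circle persists in the
disc, by the maximum modulus principle for `exp (-F)`. -/
theorem le_re_of_le_re_toCircle {F : ℂ → ℂ} (hF : Differentiable ℂ F) {m : ℝ}
    (hm : ∀ t : 𝕋, m ≤ (F (toCircle t)).re) {z : ℂ} (hz : z ∈ Metric.closedBall (0 : ℂ) 1) :
    m ≤ (F z).re := by
  have h : ‖Complex.exp (-F z)‖ ≤ Real.exp (-m) := by
    refine Complex.norm_le_of_forall_mem_frontier_norm_le (U := Metric.ball 0 1)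
      Metric.isBounded_ball (f := fun z => Complex.exp (-F z))
      (Differentiable.diffContOnCl hF.neg.cexp) (fun w hw => ?_) ?_
    · rw [frontier_ball _ one_ne_zero, mem_sphere_zero_iff_norm] at hw
      obtain ⟨t, rfl⟩ := exists_toCircle_eq hw
      rw [Complex.norm_exp, Complex.neg_re]
      exact Real.exp_le_exp.2 (neg_le_neg (hm t))
    · rwa [closure_ball _ one_ne_zero]
  rw [Complex.norm_exp, Complex.neg_re, Real.exp_le_exp] at h
  linarith

lemma integrable_of_continuous {E : Type*} [NormedAddCommGroup E] {g : 𝕋 → E}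
    (hg : Continuous g) : Integrable g (haarAddCircle (T := 2 * π)) :=
  hg.integrable_of_hasCompactSupport (HasCompactSupport.of_compactSpace g)

lemma continuous_toCircle_coe : Continuous fun t : 𝕋 => (toCircle t : ℂ) :=
  continuous_subtype_val.comp continuous_toCircle

/-- M. Riesz's inequality for holomorphic functions with positive real part: the mean value
property of `F ^ r` disposes of the second term in the pointwise inequality
`‖z‖ ^ r ≤ A (re z) ^ r - B re (z ^ r)`. -/
theorem exists_integral_norm_rpow_le {r : ℝ} (hr : 1 < r) (hr2 : r ≤ 2) :
    ∃ A : ℝ, 0 ≤ A ∧ ∀ (F : ℂ → ℂ) (m : ℝ), Differentiable ℂ F → 0 < m →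
      (∀ t : 𝕋, m ≤ (F (toCircle t)).re) → (F 0).im = 0 →
      ∫ t : 𝕋, ‖F (toCircle t)‖ ^ r ∂haarAddCircle ≤
        A * ∫ t : 𝕋, (F (toCircle t)).re ^ r ∂haarAddCircle := by
  obtain ⟨A, B, hA, hB, h⟩ := exists_norm_rpow_le hr hr2
  refine ⟨A, hA, fun F m hF hm hFm hF0 => ?_⟩
  have hr0 : 0 ≤ r := by linarith
  have hpos : ∀ z ∈ Metric.closedBall (0 : ℂ) 1, 0 < (F z).re := fun z hz =>
    hm.trans_le (le_re_of_le_re_toCircle hF hFm hz)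
  have hd : ∀ z ∈ Metric.closedBall (0 : ℂ) 1, DifferentiableAt ℂ (fun z => F z ^ (r : ℂ)) z :=
    fun z hz => (hF z).cpow_const (.inl (hpos z hz))
  have hmean : ∫ t : 𝕋, F (toCircle t) ^ (r : ℂ) ∂haarAddCircle = F 0 ^ (r : ℂ) := by
    rw [← circleAverage_eq_integral_toCircle fun z => F z ^ (r : ℂ)]
    refine circleAverage_of_differentiable_on_off_countable Set.countable_empty ?_ ?_
    · rw [abs_one]
      exact fun z hz => (hd z hz).continuousAt.continuousWithinAt
    · rw [abs_one]
      exact fun z hz => hd z (Metric.ball_subset_closedBall hz.1)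
  have hcont : Continuous fun t : 𝕋 => F (toCircle t) :=
    hF.continuous.comp continuous_toCircle_coe
  have hmem (t : 𝕋) : (toCircle t : ℂ) ∈ Metric.closedBall (0 : ℂ) 1 :=
    mem_closedBall_zero_iff.2 (norm_toCircle t).le
  have hcpow : Continuous fun t : 𝕋 => F (toCircle t) ^ (r : ℂ) :=
    continuous_iff_continuousAt.2 fun t =>
      ContinuousAt.comp (f := fun t : 𝕋 => (toCircle t : ℂ)) (hd _ (hmem t)).continuousAt
        continuous_toCircle_coe.continuousAt
  have hF0' : 0 ≤ (F 0 ^ (r : ℂ)).re := by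
    have h0 := hpos 0 (by simp)
    rw [Complex.cpow_ofReal_re, Complex.arg_eq_zero_iff.2 ⟨h0.le, hF0⟩, zero_mul, Real.cos_zero,
      mul_one]
    positivity
  have i1 : Integrable (fun t : 𝕋 => (F (toCircle t)).re ^ r) haarAddCircle :=
    integrable_of_continuous ((Complex.continuous_re.comp hcont).rpow_const fun _ => .inr hr0)
  have i2 : Integrable (fun t : 𝕋 => F (toCircle t) ^ (r : ℂ)) haarAddCircle :=
    integrable_of_continuous hcpow
  have i3 : Integrable (fun t : 𝕋 => (F (toCircle t) ^ (r : ℂ)).re) haarAddCircle := i2.re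
  calc ∫ t : 𝕋, ‖F (toCircle t)‖ ^ r ∂haarAddCircle
      ≤ ∫ t : 𝕋, (A * (F (toCircle t)).re ^ r - B * (F (toCircle t) ^ (r : ℂ)).re)
          ∂haarAddCircle :=
        integral_mono (integrable_of_continuous (hcont.norm.rpow_const fun _ => .inr hr0))
          ((i1.const_mul A).sub (i3.const_mul B)) fun t => h _ (hpos _ (hmem t))
    _ = A * ∫ t : 𝕋, (F (toCircle t)).re ^ r ∂haarAddCircle - B * (F 0 ^ (r : ℂ)).re := by
        rw [integral_sub (i1.const_mul A) (i3.const_mul B), integral_const_mul,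
          integral_const_mul, ← hmean]
        congr 2
        exact integral_re i2
    _ ≤ _ := by
        have := mul_nonneg hB hF0'
        linarith

end Disc

/-! ### Trigonometric polynomials -/

section TrigonometricPolynomials

/-- The trigonometric polynomial with the given coefficients. -/
noncomputable def trigPoly : (ℤ →₀ ℂ) →ₗ[ℂ] C(𝕋, ℂ) :=
  Finsupp.linearCombination ℂ (fourier (T := 2 * π))

/-- The Riesz projection on coefficient sequences: it keeps the coefficients with nonnegative
index. -/
noncomputable def analyticPart : (ℤ →₀ ℂ) →ₗ[ℂ] (ℤ →₀ ℂ) where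
  toFun a := a.filter (0 ≤ ·)
  map_add' _ _ := Finsupp.filter_add
  map_smul' _ _ := Finsupp.filter_smul

lemma trigPoly_single (n : ℤ) (c : ℂ) :
    trigPoly (.single n c) = c • fourier n := Finsupp.linearCombination_single ℂ c n

lemma analyticPart_single_of_nonneg {n : ℤ} (hn : 0 ≤ n) (c : ℂ) :
    analyticPart (.single n c) = .single n c := Finsupp.filter_single_of_pos _ hn

lemma analyticPart_single_of_neg {n : ℤ} (hn : n < 0) (c : ℂ) :
    analyticPart (.single n c) = 0 := Finsupp.filter_single_of_neg _ (not_le.2 hn)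

lemma denseRange_trigPoly : DenseRange trigPoly := by
  rw [DenseRange, dense_iff_closure_eq]
  have := span_fourier_closure_eq_top (T := 2 * π)
  rw [← Finsupp.range_linearCombination] at this
  exact congrArg (fun S : Submodule ℂ C(𝕋, ℂ) => (S : Set C(𝕋, ℂ))) this

/-- The real part of a trigonometric polynomial is again one, with coefficients `c`, and it is the
real part on the circle of an entire function `F`, real at the origin, whose values determine the
analytic part of `c`. -/
theorem exists_re_trigPoly (a : ℤ →₀ ℂ) :
    ∃ (c : ℤ →₀ ℂ) (F : ℂ → ℂ), Differentiable ℂ F ∧ (F 0).im = 0 ∧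
      (∀ t, trigPoly c t = ((trigPoly a t).re : ℂ)) ∧
      (∀ t : 𝕋, (F (toCircle t)).re = (trigPoly a t).re) ∧
      ∀ t : 𝕋, 2 * trigPoly (analyticPart c) t = F (toCircle t) + F 0 := by
  -- `re (x z ^ k)` has coefficients `x / 2` at `k` and `conj x / 2` at `-k`.
  have hmono (x : ℂ) (k : ℕ) (hk : k ≠ 0) :
      ∃ (c : ℤ →₀ ℂ) (F : ℂ → ℂ), Differentiable ℂ F ∧ (F 0).im = 0 ∧
        (∀ t, trigPoly c t = ((x * fourier k t).re : ℂ)) ∧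
        (∀ t : 𝕋, (F (toCircle t)).re = (x * fourier k t).re) ∧
        ∀ t : 𝕋, 2 * trigPoly (analyticPart c) t = F (toCircle t) + F 0 := by
    have hk' (t : 𝕋) : (fourier (k : ℤ) t : ℂ) = (toCircle t : ℂ) ^ k := by
      rw [fourier_apply, toCircle_zsmul, zpow_natCast, Circle.coe_pow]
    refine ⟨.single k (x / 2) + .single (-k) (star x / 2), fun z => x * z ^ k, by fun_prop,
      by simp [hk], fun t => ?_, fun t => ?_, fun t => ?_⟩
    · rw [map_add, trigPoly_single, trigPoly_single, ContinuousMap.add_apply,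
        ContinuousMap.smul_apply, ContinuousMap.smul_apply, fourier_neg, smul_eq_mul, smul_eq_mul,
        Complex.re_eq_add_conj, map_mul]
      simp only [Complex.star_def]
      ring
    · rw [hk']
    · rw [map_add, analyticPart_single_of_nonneg (by positivity),
        analyticPart_single_of_neg (by lia), add_zero, trigPoly_single, ContinuousMap.smul_apply,
        smul_eq_mul, hk']
      simp only [zero_pow hk]
      ring
  induction a using Finsupp.induction_linear with
  | zero => exact ⟨0, 0, differentiable_const 0, by simp, by simp, by simp, by simp⟩
  | add a b ha hb =>
    obtain ⟨c, F, h1, h2, h3, h4, h5⟩ := ha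
    obtain ⟨d, G, g1, g2, g3, g4, g5⟩ := hb
    refine ⟨c + d, F + G, h1.add g1, ?_, fun t => ?_, fun t => ?_, fun t => ?_⟩
    · rw [Pi.add_apply, Complex.add_im, h2, g2, add_zero]
    · rw [map_add, map_add, ContinuousMap.add_apply, h3, g3, ContinuousMap.add_apply,
        Complex.add_re, Complex.ofReal_add]
    · rw [map_add, Pi.add_apply, Complex.add_re, h4, g4, ContinuousMap.add_apply, Complex.add_re]
    · rw [map_add, map_add, ContinuousMap.add_apply, mul_add, h5, g5, Pi.add_apply, Pi.add_apply]
      ring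
  | single n x =>
    simp only [trigPoly_single, ContinuousMap.smul_apply, smul_eq_mul]
    rcases lt_trichotomy n 0 with hn | rfl | hn
    · obtain ⟨k, rfl⟩ : ∃ k : ℕ, n = -(k : ℤ) := ⟨n.natAbs, by lia⟩
      have hre (t : 𝕋) : (x * fourier (-(k : ℤ)) t).re = (star x * fourier (k : ℤ) t).re := by
        rw [← Complex.conj_re, map_mul, fourier_neg, Complex.conj_conj, Complex.star_def]
      simp only [hre]
      exact hmono (star x) k (by lia)
    · refine ⟨.single 0 (x.re : ℂ), fun _ => x.re, differentiable_const _, Complex.ofReal_im _,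
        fun t => ?_, fun t => ?_, fun t => ?_⟩
      · simp [trigPoly_single]
      · simp
      · rw [analyticPart_single_of_nonneg le_rfl, trigPoly_single]
        simp [two_mul]
    · obtain ⟨k, rfl⟩ : ∃ k : ℕ, n = (k : ℤ) := ⟨n.natAbs, by lia⟩
      exact hmono x k (by lia)

end TrigonometricPolynomials

section Norms

variable (p : ℝ≥0∞) [Fact (1 ≤ p)]

/-- A continuous function on the circle as an element of `L^p`. -/
noncomputable abbrev contToLp : C(𝕋, ℂ) →L[ℂ] LpCircle p :=
  ContinuousMap.toLp p (haarAddCircle (T := 2 * π)) ℂ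

lemma norm_contToLp (g : C(𝕋, ℂ)) :
    ‖contToLp p g‖ = (eLpNorm g p (haarAddCircle (T := 2 * π))).toReal := by
  rw [Lp.norm_def, eLpNorm_congr_ae (ContinuousMap.coeFn_toLp _ g)]

lemma norm_contToLp_le (g : C(𝕋, ℂ)) {M : ℝ} (hM : 0 ≤ M) (hg : ∀ t, ‖g t‖ ≤ M) :
    ‖contToLp p g‖ ≤ M := by
  refine (Lp.norm_le_of_ae_bound hM (C := M) (f := contToLp p g) ?_).trans
    (by simp [measureUnivNNReal])
  filter_upwards [ContinuousMap.coeFn_toLp (p := p) (𝕜 := ℂ) (haarAddCircle (T := 2 * π)) g]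
    with t ht
  rw [ht]
  exact hg t

variable {p}

lemma memLp_cont (g : C(𝕋, ℂ)) : MemLp g p (haarAddCircle (T := 2 * π)) :=
  (memLp_congr_ae (ContinuousMap.coeFn_toLp (𝕜 := ℂ) _ g)).1 (Lp.memLp (contToLp p g))

lemma norm_contToLp_mono {g h : C(𝕋, ℂ)} (hgh : ∀ t, ‖g t‖ ≤ ‖h t‖) :
    ‖contToLp p g‖ ≤ ‖contToLp p h‖ := by
  rw [norm_contToLp, norm_contToLp]
  exact ENNReal.toReal_mono (memLp_cont h).eLpNorm_ne_top (eLpNorm_mono hgh)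

lemma norm_contToLp_le_of_exponent_le {q : ℝ≥0∞} [Fact (1 ≤ q)] (hpq : p ≤ q) (g : C(𝕋, ℂ)) :
    ‖contToLp p g‖ ≤ ‖contToLp q g‖ := by
  rw [norm_contToLp, norm_contToLp]
  exact ENNReal.toReal_mono (memLp_cont g).eLpNorm_ne_top
    (eLpNorm_le_eLpNorm_of_exponent_le hpq g.continuous.aestronglyMeasurable)

lemma toReal_exponent_pos (hp' : p ≠ ∞) : 0 < p.toReal :=
  ENNReal.toReal_pos (zero_lt_one.trans_le Fact.out).ne' hp'

lemma norm_contToLp_rpow (hp' : p ≠ ∞) (g : C(𝕋, ℂ)) :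
    ‖contToLp p g‖ ^ p.toReal = ∫ t, ‖g t‖ ^ p.toReal ∂(haarAddCircle (T := 2 * π)) := by
  have hp := toReal_exponent_pos hp'
  have hint : 0 ≤ ∫ t, ‖g t‖ ^ p.toReal ∂(haarAddCircle (T := 2 * π)) :=
    integral_nonneg fun t => by positivity
  rw [norm_contToLp, MemLp.eLpNorm_eq_integral_rpow_norm (zero_lt_one.trans_le Fact.out).ne' hp'
    (memLp_cont g), ENNReal.toReal_ofReal (by positivity), ← Real.rpow_mul hint,
    inv_mul_cancel₀ hp.ne', Real.rpow_one]

lemma norm_coeffCLM_le (n : ℤ) (g : LpCircle p) : ‖coeffCLM p n g‖ ≤ ‖g‖ := by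
  have := (coeffCLM p n).le_of_opNorm_le (LinearMap.mkContinuous_norm_le _ zero_le_one _) g
  rwa [one_mul] at this

lemma contToLp_fourier (n : ℤ) : contToLp p (fourier n) = fourierLp p n := rfl

/-- Orthogonality of the exponentials: the analytic part is a contraction in `L²`. -/
lemma norm_contToLp_two_analyticPart_le (a : ℤ →₀ ℂ) :
    ‖contToLp 2 (trigPoly (analyticPart a))‖ ≤ ‖contToLp 2 (trigPoly a)‖ := by
  have hlc (b : ℤ →₀ ℂ) : contToLp 2 (trigPoly b) =
      Finsupp.linearCombination ℂ (fourierLp (T := 2 * π) 2) b :=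
    Finsupp.apply_linearCombination ℂ (contToLp 2 : C(𝕋, ℂ) →ₗ[ℂ] LpCircle 2) _ _
  have horth : inner ℂ (contToLp 2 (trigPoly (analyticPart a)))
      (contToLp 2 (trigPoly (a - analyticPart a))) = 0 := by
    rw [hlc, hlc, orthonormal_fourier.inner_finsupp_eq_sum_left]
    refine Finset.sum_eq_zero fun n hn => ?_
    have hn' : 0 ≤ n := (Finsupp.mem_support_iff.1 hn |> fun h => by
      by_contra hneg
      exact h (Finsupp.filter_apply_neg _ a hneg))
    have : (a - analyticPart a) n = 0 := by
      rw [Finsupp.sub_apply, sub_eq_zero]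
      exact (Finsupp.filter_apply_pos _ a hn').symm
    simp only [this, mul_zero]
  have hsum : contToLp 2 (trigPoly a) = contToLp 2 (trigPoly (analyticPart a)) +
      contToLp 2 (trigPoly (a - analyticPart a)) := by
    rw [← map_add, ← map_add, add_sub_cancel]
  have := norm_add_sq_eq_norm_sq_add_norm_sq_of_inner_eq_zero _ _ horth
  rw [← hsum] at this
  nlinarith [norm_nonneg (contToLp 2 (trigPoly a)),
    norm_nonneg (contToLp 2 (trigPoly (analyticPart a))),
    norm_nonneg (contToLp 2 (trigPoly (a - analyticPart a)))]

end Norms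

/-! ### Boundedness of the Riesz projection -/

section Boundedness

variable {p : ℝ≥0∞} [Fact (1 ≤ p)]

/-- M. Riesz's inequality for trigonometric polynomials with positive real part. -/
theorem exists_norm_analyticPart_re_le (hp : 1 < p) (hp2 : p ≤ 2) :
    ∃ C : ℝ, 0 ≤ C ∧ ∀ (a : ℤ →₀ ℂ) (m : ℝ), 0 < m → (∀ t, m ≤ (trigPoly a t).re) →
      ∃ c : ℤ →₀ ℂ, (∀ t, trigPoly c t = ((trigPoly a t).re : ℂ)) ∧
        ‖contToLp p (trigPoly (analyticPart c))‖ ≤ C * ‖contToLp p (trigPoly c)‖ := by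
  have hp' : p ≠ ∞ := (hp2.trans_lt ENNReal.ofNat_lt_top).ne
  have hr := toReal_exponent_pos hp'
  obtain ⟨A, hA, hmain⟩ := exists_integral_norm_rpow_le (r := p.toReal)
    (by simpa using (ENNReal.toReal_lt_toReal ENNReal.one_ne_top hp').2 hp)
    (by simpa using ENNReal.toReal_mono ENNReal.ofNat_ne_top hp2)
  refine ⟨A ^ p.toReal⁻¹, by positivity, fun a m hm ha => ?_⟩
  obtain ⟨c, F, hF, hF0, hc, hFa, hcF⟩ := exists_re_trigPoly a
  refine ⟨c, hc, ?_⟩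
  let f : C(𝕋, ℂ) := ⟨fun t => F (toCircle t), hF.continuous.comp continuous_toCircle_coe⟩
  have hf : ‖contToLp p f‖ ≤ A ^ p.toReal⁻¹ * ‖contToLp p (trigPoly c)‖ := by
    have h1 := hmain F m hF hm (fun t => (ha t).trans_eq (hFa t).symm) hF0
    have h2 : ∫ t : 𝕋, (F (toCircle t)).re ^ p.toReal ∂haarAddCircle =
        ‖contToLp p (trigPoly c)‖ ^ p.toReal := by
      rw [norm_contToLp_rpow hp']
      refine integral_congr_ae (.of_forall fun t => ?_)
      simp only [hFa, hc, Complex.norm_real, Real.norm_of_nonneg (hm.le.trans (ha t))]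
    have h3 := norm_contToLp_rpow hp' f
    rw [h2] at h1
    rw [← Real.rpow_le_rpow_iff (norm_nonneg _) (by positivity) hr,
      Real.mul_rpow (by positivity) (norm_nonneg _), ← Real.rpow_mul hA,
      inv_mul_cancel₀ hr.ne', Real.rpow_one, h3]
    exact h1
  -- By the mean value property `F 0` is the zeroth Fourier coefficient of `F` on the circle.
  have hF0' : ‖F 0‖ ≤ ‖contToLp p f‖ := by
    have h1 : coeffCLM p 0 (contToLp p f) = F 0 := by
      have hmean : Real.circleAverage F 0 1 = F 0 :=
        circleAverage_of_differentiable_on_off_countable Set.countable_empty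
          hF.continuous.continuousOn fun z _ => hF z
      rw [coeffCLM_toLp, ← hmean, circleAverage_eq_integral_toCircle]
      refine integral_congr_ae (.of_forall fun t => ?_)
      simp [f]
    rw [← h1]
    exact norm_coeffCLM_le 0 _
  have hsum : (2 : ℂ) • contToLp p (trigPoly (analyticPart c)) =
      contToLp p f + contToLp p (.const _ (F 0)) := by
    rw [← map_smul, ← map_add]
    congr 1
    ext t
    exact hcF t
  have hconst : ‖contToLp p (.const _ (F 0))‖ ≤ ‖F 0‖ :=
    norm_contToLp_le p _ (norm_nonneg _) fun t => le_rfl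
  have h2 : 2 * ‖contToLp p (trigPoly (analyticPart c))‖ ≤ ‖contToLp p f‖ + ‖F 0‖ := by
    have := congrArg norm hsum
    rw [norm_smul, Complex.norm_ofNat] at this
    rw [this]
    exact (norm_add_le _ _).trans (by gcongr)
  linarith

/-- Nonnegative continuous functions are uniform limits of trigonometric polynomials for which the
analytic part is controlled. -/
theorem exists_trigPoly_near_of_nonneg (hp : 1 < p) (hp2 : p ≤ 2) :
    ∃ C : ℝ, 0 ≤ C ∧ ∀ (f : C(𝕋, ℂ)) (u : 𝕋 → ℝ), Continuous u → (∀ t, 0 ≤ u t) →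
      (∀ t, u t ≤ ‖f t‖) → ∀ ε > 0, ∃ c : ℤ →₀ ℂ, (∀ t, ‖trigPoly c t - (u t : ℂ)‖ ≤ ε) ∧
        ‖contToLp p (trigPoly (analyticPart c))‖ ≤ C * (‖contToLp p f‖ + ε) := by
  obtain ⟨C, hC, hmain⟩ := exists_norm_analyticPart_re_le hp hp2
  refine ⟨C, hC, fun f u hu hu0 hle ε hε => ?_⟩
  -- Shifting `u` up by `ε / 2` keeps the approximating polynomials positive.
  let v : C(𝕋, ℂ) := ⟨fun t => ((u t + ε / 2 : ℝ) : ℂ), by fun_prop⟩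
  obtain ⟨a, ha⟩ := denseRange_trigPoly.exists_dist_lt v (show 0 < ε / 4 by positivity)
  have ha' (t : 𝕋) : |(trigPoly a t).re - (u t + ε / 2)| ≤ ε / 4 := by
    have h1 := (ContinuousMap.dist_lt_iff (by positivity)).1 ha t
    rw [dist_comm, dist_eq_norm] at h1
    refine le_trans ?_ h1.le
    exact Complex.abs_re_le_norm (trigPoly a t - v t)
  obtain ⟨c, hc, hcC⟩ := hmain a (ε / 4) (by positivity) fun t => by
    linarith [(abs_le.1 (ha' t)).1, hu0 t]
  have hcu (t : 𝕋) : ‖trigPoly c t - (u t : ℂ)‖ ≤ ε := by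
    rw [hc, ← Complex.ofReal_sub, Complex.norm_real, Real.norm_eq_abs, abs_le]
    constructor <;> linarith [(abs_le.1 (ha' t)).1, (abs_le.1 (ha' t)).2]
  refine ⟨c, hcu, hcC.trans ?_⟩
  gcongr
  let u' : C(𝕋, ℂ) := ⟨fun t => (u t : ℂ), by fun_prop⟩
  have h1 : ‖contToLp p u'‖ ≤ ‖contToLp p f‖ := norm_contToLp_mono fun t => by
    change ‖(u t : ℂ)‖ ≤ _
    rw [Complex.norm_real, Real.norm_of_nonneg (hu0 t)]
    exact hle t
  have h2 : ‖contToLp p (trigPoly c - u')‖ ≤ ε := norm_contToLp_le p _ hε.le hcu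
  calc ‖contToLp p (trigPoly c)‖ = ‖contToLp p u' + contToLp p (trigPoly c - u')‖ := by
        rw [← map_add, add_sub_cancel]
    _ ≤ _ := (norm_add_le _ _).trans (add_le_add h1 h2)

theorem exists_trigPoly_near_of_real (hp : 1 < p) (hp2 : p ≤ 2) :
    ∃ C : ℝ, 0 ≤ C ∧ ∀ (f : C(𝕋, ℂ)) (u : 𝕋 → ℝ), Continuous u → (∀ t, |u t| ≤ ‖f t‖) →
      ∀ ε > 0, ∃ c : ℤ →₀ ℂ, (∀ t, ‖trigPoly c t - (u t : ℂ)‖ ≤ 2 * ε) ∧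
        ‖contToLp p (trigPoly (analyticPart c))‖ ≤ 2 * (C * (‖contToLp p f‖ + ε)) := by
  obtain ⟨C, hC, hmain⟩ := exists_trigPoly_near_of_nonneg hp hp2
  refine ⟨C, hC, fun f u hu hle ε hε => ?_⟩
  obtain ⟨c, hc, hcC⟩ := hmain f (fun t => max (u t) 0) (hu.max continuous_const)
    (fun t => le_max_right _ _)
    (fun t => max_le ((le_abs_self _).trans (hle t)) (norm_nonneg _)) ε hε
  obtain ⟨d, hd, hdC⟩ := hmain f (fun t => max (-u t) 0) (hu.neg.max continuous_const)
    (fun t => le_max_right _ _)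
    (fun t => max_le ((neg_le_abs _).trans (hle t)) (norm_nonneg _)) ε hε
  refine ⟨c - d, fun t => ?_, ?_⟩
  · have hu' : (u t : ℂ) = (max (u t) 0 : ℝ) - (max (-u t) 0 : ℝ) := by
      rw [← Complex.ofReal_sub]
      exact congrArg _ (posPart_sub_negPart (u t)).symm
    rw [hu', map_sub, ContinuousMap.sub_apply, sub_sub_sub_comm]
    exact (norm_sub_le _ _).trans (by linarith [hc t, hd t])
  · rw [map_sub, map_sub, map_sub]
    exact (norm_sub_le _ _).trans (by linarith)

theorem exists_trigPoly_near (hp : 1 < p) (hp2 : p ≤ 2) :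
    ∃ C : ℝ, 0 ≤ C ∧ ∀ (f : C(𝕋, ℂ)), ∀ ε > 0,
      ∃ c : ℤ →₀ ℂ, (∀ t, ‖trigPoly c t - f t‖ ≤ 4 * ε) ∧
        ‖contToLp p (trigPoly (analyticPart c))‖ ≤ 4 * (C * (‖contToLp p f‖ + ε)) := by
  obtain ⟨C, hC, hmain⟩ := exists_trigPoly_near_of_real hp hp2
  refine ⟨C, hC, fun f ε hε => ?_⟩
  obtain ⟨c, hc, hcC⟩ := hmain f (fun t => (f t).re) (Complex.continuous_re.comp f.continuous)
    (fun t => Complex.abs_re_le_norm _) ε hε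
  obtain ⟨d, hd, hdC⟩ := hmain f (fun t => (f t).im) (Complex.continuous_im.comp f.continuous)
    (fun t => Complex.abs_im_le_norm _) ε hε
  refine ⟨c + Complex.I • d, fun t => ?_, ?_⟩
  · have hf : trigPoly (c + Complex.I • d) t - f t =
        (trigPoly c t - (f t).re) + Complex.I * (trigPoly d t - (f t).im) := by
      rw [map_add, map_smul, ContinuousMap.add_apply, ContinuousMap.smul_apply, smul_eq_mul]
      linear_combination Complex.re_add_im (f t)
    rw [hf]
    refine (norm_add_le _ _).trans ?_
    rw [norm_mul, Complex.norm_I, one_mul]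
    linarith [hc t, hd t]
  · rw [map_add, map_smul, map_add, map_smul, map_add, map_smul]
    refine (norm_add_le _ _).trans ?_
    rw [norm_smul, Complex.norm_I, one_mul]
    linarith

/-- The analytic part is bounded in `L^p` for `1 < p ≤ 2`: up to a uniformly small remainder, for
which the `L²` bound suffices, the estimate for positive trigonometric polynomials applies. -/
theorem exists_norm_analyticPart_le (hp : 1 < p) (hp2 : p ≤ 2) :
    ∃ C : ℝ, ∀ a : ℤ →₀ ℂ,
      ‖contToLp p (trigPoly (analyticPart a))‖ ≤ C * ‖contToLp p (trigPoly a)‖ := by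
  obtain ⟨C, hC, hmain⟩ := exists_trigPoly_near hp hp2
  refine ⟨4 * C, fun a => ?_⟩
  have hε (ε : ℝ) (hε : 0 < ε) : ‖contToLp p (trigPoly (analyticPart a))‖ ≤
      4 * C * ‖contToLp p (trigPoly a)‖ + (4 * C + 4) * ε := by
    obtain ⟨c, hc, hcC⟩ := hmain (trigPoly a) ε hε
    have hrem : ‖contToLp p (trigPoly (analyticPart (c - a)))‖ ≤ 4 * ε :=
      (norm_contToLp_le_of_exponent_le hp2 _).trans
        ((norm_contToLp_two_analyticPart_le _).trans
          (norm_contToLp_le 2 _ (by positivity) fun t => by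
            rw [map_sub, ContinuousMap.sub_apply]
            exact hc t))
    have hsum : contToLp p (trigPoly (analyticPart a)) =
        contToLp p (trigPoly (analyticPart c)) - contToLp p (trigPoly (analyticPart (c - a))) := by
      rw [← map_sub, ← map_sub, ← map_sub, sub_sub_cancel]
    rw [hsum]
    refine (norm_sub_le _ _).trans ?_
    linarith
  refine le_of_forall_pos_le_add fun δ hδ => (hε (δ / (4 * C + 4)) (by positivity)).trans ?_
  rw [mul_div_cancel₀ _ (by positivity)]

/-- A bound for the analytic part of trigonometric polynomials extends, by density, to the Riesz
projection on `L^p`. -/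
theorem nonempty_rieszProjection_of_bound (hp' : p ≠ ∞)
    (h : ∃ C : ℝ, ∀ a : ℤ →₀ ℂ,
      ‖contToLp p (trigPoly (analyticPart a))‖ ≤ C * ‖contToLp p (trigPoly a)‖) :
    Nonempty (RieszProjection p) := by
  let e : (ℤ →₀ ℂ) →ₗ[ℂ] LpCircle p := (contToLp p : C(𝕋, ℂ) →ₗ[ℂ] LpCircle p) ∘ₗ trigPoly
  have hdense : DenseRange e :=
    (ContinuousMap.toLp_denseRange ℂ (haarAddCircle (T := 2 * π)) ℂ hp').comp denseRange_trigPoly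
      (contToLp p).continuous
  let P : LpCircle p →L[ℂ] LpCircle p := (e ∘ₗ analyticPart).extendOfNorm e
  have hP (a : ℤ →₀ ℂ) : P (e a) = e (analyticPart a) := LinearMap.extendOfNorm_eq hdense h a
  have he (n : ℤ) : e (.single n 1) = fourierLp p n := by
    change contToLp p (trigPoly _) = _
    rw [trigPoly_single, one_smul]
  refine ⟨⟨P, fun g n => ?_⟩⟩
  have hcoef : coeffCLM p n ∘L P = if 0 ≤ n then coeffCLM p n else 0 := by
    refine ContinuousLinearMap.ext_on (s := Set.range (fourierLp p)) ?_ ?_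
    · rw [dense_iff_closure_eq, ← Submodule.topologicalClosure_coe,
        span_fourierLp_closure_eq_top hp', Submodule.top_coe]
    · rintro _ ⟨m, rfl⟩
      rw [ContinuousLinearMap.comp_apply, ← he, hP]
      rcases le_or_gt 0 m with hm | hm
      · rw [analyticPart_single_of_nonneg hm, he]
        split_ifs with hn
        · rfl
        · rw [coeffCLM_fourierLp, if_neg (by lia)]
          rfl
      · rw [analyticPart_single_of_neg hm, map_zero, map_zero, he]
        split_ifs with hn
        · rw [coeffCLM_fourierLp, if_neg (by lia)]
        · rfl
  have := DFunLike.congr_fun hcoef g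
  rw [ContinuousLinearMap.comp_apply, coeffCLM_apply] at this
  rw [this]
  split_ifs <;> rfl

end Boundedness

section Duality

variable {p q : ℝ≥0∞} [Fact (1 ≤ p)] [Fact (1 ≤ q)]

/-- The transpose of the analytic part with respect to the bilinear pairing of `L^q` and `L^p`
keeps the coefficients with index `n ≤ 0`; it is bounded on `L^q` along with `P`. -/
theorem exists_lpPairing_analyticPart [q.HolderConjugate p] (P : RieszProjection q) :
    ∃ R : LpCircle q →L[ℂ] LpCircle q, ∀ (h : LpCircle q) (a : ℤ →₀ ℂ),
      (ContinuousLinearMap.mul ℂ ℂ).lpPairing (haarAddCircle (T := 2 * π)) q p h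
          (contToLp p (trigPoly (analyticPart a))) =
        (ContinuousLinearMap.mul ℂ ℂ).lpPairing (haarAddCircle (T := 2 * π)) q p (R h)
          (contToLp p (trigPoly a)) := by
  refine ⟨P.compl + (coeffCLM q 0).smulRight (fourierLp q 0), fun h a => ?_⟩
  induction a using Finsupp.induction_linear with
  | zero => simp only [map_zero]
  | add a b ha hb => simp only [map_add (analyticPart), map_add (trigPoly),
      map_add (contToLp p), map_add ((ContinuousLinearMap.lpPairing _ q p _) _), ha, hb]
  | single n x =>
    have hR : coeffCLM q (-n)
        ((P.compl + (coeffCLM q 0).smulRight (fourierLp q 0) : LpCircle q →L[ℂ] LpCircle q) h) =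
          if 0 ≤ n then coeffCLM q (-n) h else 0 := by
      rw [add_apply, ContinuousLinearMap.smulRight_apply, map_add, map_smul, P.coeffCLM_compl,
        coeffCLM_fourierLp, smul_eq_mul]
      rcases lt_trichotomy n 0 with hn | rfl | hn
      · rw [if_pos (by lia), if_neg (by lia), if_neg (by lia), mul_zero, add_zero]
      · simp
      · rw [if_neg (by lia), if_neg (by lia), if_pos hn.le, mul_zero, add_zero]
    rw [trigPoly_single, map_smul, map_smul, contToLp_fourier, lpPairing_fourierLp, hR]
    split_ifs with hn
    · rw [analyticPart_single_of_nonneg hn, trigPoly_single, map_smul, map_smul, contToLp_fourier,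
        lpPairing_fourierLp]
    · rw [analyticPart_single_of_neg (not_le.1 hn), smul_zero]
      simp only [map_zero]

/-- The function `conj u ‖u‖ ^ (p - 2)` norms `u` in the duality of `L^p` and `L^q`. -/
theorem exists_lpPairing_eq_norm_rpow [q.HolderConjugate p] (hp2 : 2 < p) (hp' : p ≠ ∞)
    (u : C(𝕋, ℂ)) :
    ∃ h : LpCircle q, ‖h‖ = ‖contToLp p u‖ ^ (p.toReal - 1) ∧
      ‖(ContinuousLinearMap.mul ℂ ℂ).lpPairing (haarAddCircle (T := 2 * π)) q p h
        (contToLp p u)‖ = ‖contToLp p u‖ ^ p.toReal := by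
  have hr2 : 2 < p.toReal := by
    simpa using (ENNReal.toReal_lt_toReal ENNReal.ofNat_ne_top hp').2 hp2
  have hq' : q ≠ ∞ := fun h => by
    have := ENNReal.HolderConjugate.inv_add_inv_eq_one q p
    rw [h, ENNReal.inv_top, zero_add, ENNReal.inv_eq_one] at this
    rw [this] at hp2
    exact absurd hp2 (by norm_num)
  have hconj : q.toReal.HolderConjugate p.toReal :=
    ENNReal.HolderConjugate.toReal_of_ne_top hq' hp'
  let h : C(𝕋, ℂ) := ⟨fun t => star (u t) * ((‖u t‖ ^ (p.toReal - 2) : ℝ) : ℂ), by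
    refine (continuous_star.comp u.continuous).mul (Complex.continuous_ofReal.comp ?_)
    exact u.continuous.norm.rpow_const fun _ => .inr (by linarith)⟩
  have hnorm (t : 𝕋) : ‖h t‖ = ‖u t‖ ^ (p.toReal - 1) := by
    change ‖star (u t) * ((‖u t‖ ^ (p.toReal - 2) : ℝ) : ℂ)‖ = _
    rw [norm_mul, norm_star, Complex.norm_real, Real.norm_of_nonneg (by positivity)]
    have := Real.rpow_add_of_nonneg (norm_nonneg (u t)) zero_le_one
      (by linarith : 0 ≤ p.toReal - 2)
    rw [Real.rpow_one] at this
    rw [← this]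
    congr 1
    ring
  refine ⟨contToLp q h, ?_, ?_⟩
  · have hq0 := toReal_exponent_pos hq'
    rw [← Real.rpow_left_inj (norm_nonneg _) (by positivity) hq0.ne', norm_contToLp_rpow hq',
      ← Real.rpow_mul (norm_nonneg _), hconj.symm.sub_one_mul_conj, norm_contToLp_rpow hp']
    refine integral_congr_ae (.of_forall fun t => ?_)
    simp only [hnorm]
    rw [← Real.rpow_mul (norm_nonneg _), hconj.symm.sub_one_mul_conj]
  · have : (ContinuousLinearMap.mul ℂ ℂ).lpPairing (haarAddCircle (T := 2 * π)) q p
        (contToLp q h) (contToLp p u) = ((‖contToLp p u‖ ^ p.toReal : ℝ) : ℂ) := by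
      rw [ContinuousLinearMap.lpPairing_eq_integral, norm_contToLp_rpow hp']
      refine Eq.trans ?_ integral_ofReal
      refine integral_congr_ae ?_
      filter_upwards [ContinuousMap.coeFn_toLp (p := q) (𝕜 := ℂ) (haarAddCircle (T := 2 * π)) h,
        ContinuousMap.coeFn_toLp (p := p) (𝕜 := ℂ) (haarAddCircle (T := 2 * π)) u] with t h1 h2
      rw [h1, h2, ContinuousLinearMap.mul_apply']
      change star (u t) * ((‖u t‖ ^ (p.toReal - 2) : ℝ) : ℂ) * u t = ((‖u t‖ ^ p.toReal : ℝ) : ℂ)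
      have h3 : star (u t) * u t = ((‖u t‖ ^ (2 : ℝ) : ℝ) : ℂ) := by
        rw [Complex.star_def, Complex.conj_mul', Real.rpow_two, Complex.ofReal_pow]
      rw [mul_right_comm, h3, ← Complex.ofReal_mul,
        ← Real.rpow_add_of_nonneg (norm_nonneg _) (by norm_num) (by linarith), add_sub_cancel]
    rw [this, Complex.norm_real, Real.norm_of_nonneg (by positivity)]

theorem exists_norm_analyticPart_le_of_conjugate [q.HolderConjugate p] (hp2 : 2 < p)
    (hp' : p ≠ ∞) (P : RieszProjection q) :
    ∃ C : ℝ, ∀ a : ℤ →₀ ℂ,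
      ‖contToLp p (trigPoly (analyticPart a))‖ ≤ C * ‖contToLp p (trigPoly a)‖ := by
  obtain ⟨R, hR⟩ := exists_lpPairing_analyticPart (p := p) P
  let B := (ContinuousLinearMap.mul ℂ ℂ).lpPairing (haarAddCircle (T := 2 * π)) q p
  refine ⟨‖B‖ * ‖R‖, fun a => ?_⟩
  obtain ⟨h, hh, hB⟩ := exists_lpPairing_eq_norm_rpow (q := q) hp2 hp' (trigPoly (analyticPart a))
  rw [hR] at hB
  have h1 := B.le_opNorm₂ (R h) (contToLp p (trigPoly a))
  rw [hB] at h1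
  set x := ‖contToLp p (trigPoly (analyticPart a))‖ with hx
  rcases (hx ▸ norm_nonneg _ : 0 ≤ x).eq_or_lt with h0 | h0
  · rw [← h0]
    positivity
  · have h2 : x ^ (p.toReal - 1) * x ≤
        x ^ (p.toReal - 1) * (‖B‖ * ‖R‖ * ‖contToLp p (trigPoly a)‖) := by
      calc x ^ (p.toReal - 1) * x = x ^ p.toReal := by
            rw [Real.rpow_sub_one h0.ne', div_mul_cancel₀ _ h0.ne']
        _ ≤ ‖B‖ * ‖R h‖ * ‖contToLp p (trigPoly a)‖ := h1
        _ ≤ ‖B‖ * (‖R‖ * x ^ (p.toReal - 1)) * ‖contToLp p (trigPoly a)‖ := by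
            rw [← hh]
            gcongr
            exact R.le_opNorm h
        _ = _ := by ring
    exact le_of_mul_le_mul_left h2 (by positivity)

end Duality

/-- M. Riesz's theorem: directly for `p ≤ 2`, by duality for `p > 2`. -/
theorem nonempty_rieszProjection {p : ℝ≥0∞} [Fact (1 ≤ p)] (hp : 1 < p) (hp' : p ≠ ∞) :
    Nonempty (RieszProjection p) := by
  rcases le_or_gt p 2 with hp2 | hp2
  · exact nonempty_rieszProjection_of_bound hp' (exists_norm_analyticPart_le hp hp2)
  · let q := p.conjExponent
    have hpq : p.HolderConjugate q := .conjExponent hp.le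
    have hq1 : Fact (1 ≤ q) := ⟨hpq.symm.one_le⟩
    have hinv := ENNReal.HolderConjugate.inv_add_inv_eq_one p q
    have hq : 1 < q := by
      refine lt_of_le_of_ne hq1.out fun h => ?_
      rw [← h, inv_one] at hinv
      have : p⁻¹ = 0 := by
        refine (ENNReal.add_left_inj ENNReal.one_ne_top).1 (hinv.trans (zero_add 1).symm)
      exact hp' (ENNReal.inv_eq_zero.1 this)
    have hq2 : q ≤ 2 := by
      by_contra! hlt
      have h1 : p⁻¹ < 2⁻¹ := ENNReal.inv_lt_inv.2 hp2
      have h2 : q⁻¹ < 2⁻¹ := ENNReal.inv_lt_inv.2 hlt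
      have := ENNReal.add_lt_add h1 h2
      rw [hinv, ENNReal.inv_two_add_inv_two] at this
      exact this.false
    have hq' : q ≠ ∞ := (hq2.trans_lt ENNReal.ofNat_lt_top).ne
    obtain ⟨P⟩ := nonempty_rieszProjection_of_bound hq' (exists_norm_analyticPart_le hq hq2)
    exact nonempty_rieszProjection_of_bound hp'
      (exists_norm_analyticPart_le_of_conjugate (q := q) hp2 hp' P)

end HankelCoupling

/-- For `1 < p < ∞` the Riesz projection is bounded on `L^p`; and if `f` is in the Wiener algebra
and has no zeros on the circle, then `H_f` and `H_{1/f}` are matricially coupled, equivalent after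
extension, and generate the same operator ideal, and likewise for `H̃_f` and `H̃_{1/f}`. -/
theorem theorem4p1 (p : ℝ≥0∞) [Fact (1 ≤ p)] (hp : 1 < p) (hp' : p ≠ ∞)
    (f : C(HankelCoupling.𝕋, ℂ)) (hW : HankelCoupling.InWienerAlgebra f)
    (hf : ∀ t, f t ≠ 0) :
    Nonempty (HankelCoupling.RieszProjection p) ∧
    ∀ P : HankelCoupling.RieszProjection p,
      (HankelCoupling.MatriciallyCoupled (P.hankel (HankelCoupling.toLinfty f))
          (P.hankel (HankelCoupling.toLinfty (HankelCoupling.reciprocal f hf))) ∧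
        HankelCoupling.EquivalentAfterExtension (P.hankel (HankelCoupling.toLinfty f))
          (P.hankel (HankelCoupling.toLinfty (HankelCoupling.reciprocal f hf))) ∧
        HankelCoupling.OperatorIdeal.generatedBy (P.hankel (HankelCoupling.toLinfty f)) =
          HankelCoupling.OperatorIdeal.generatedBy
            (P.hankel (HankelCoupling.toLinfty (HankelCoupling.reciprocal f hf)))) ∧
      (HankelCoupling.MatriciallyCoupled (P.hankelTilde (HankelCoupling.toLinfty f))
          (P.hankelTilde (HankelCoupling.toLinfty (HankelCoupling.reciprocal f hf))) ∧
        HankelCoupling.EquivalentAfterExtension (P.hankelTilde (HankelCoupling.toLinfty f))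
          (P.hankelTilde (HankelCoupling.toLinfty (HankelCoupling.reciprocal f hf))) ∧
        HankelCoupling.OperatorIdeal.generatedBy (P.hankelTilde (HankelCoupling.toLinfty f)) =
          HankelCoupling.OperatorIdeal.generatedBy
            (P.hankelTilde (HankelCoupling.toLinfty (HankelCoupling.reciprocal f hf)))) := by
  refine ⟨HankelCoupling.nonempty_rieszProjection hp hp', fun P => ⟨?_, ?_⟩⟩
  · have h := P.matriciallyCoupled_hankel hp f hf
    exact ⟨h, h.equivalentAfterExtension, h.generatedBy_eq (P.isApproximable_hankel hp f)
      (P.isApproximable_hankel hp _)⟩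
  · have h := P.matriciallyCoupled_hankelTilde hp f hf
    exact ⟨h, h.equivalentAfterExtension, h.generatedBy_eq (P.isApproximable_hankelTilde hp f)
      (P.isApproximable_hankelTilde hp _)⟩
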